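/- Let $E$ be a real or complex Banach space and let $D$ be the infinitesimal generator of a strongly continuous one-parameter group of linear isometries $e^{tD}$, $t\in\mathbb{R}$, of $E$, i.e. $Df=\lim_{t\to 0}t^{-1}(e^{tD}f-f)$ on the domain where this limit exists. For $\sigma>0$ let $\mathbf{B}_\sigma(D)$ be the set of all $f\in\bigcap_{k\ge 1}\mathrm{dom}(D^k)$ such that $\|D^kf\|\le\sigma^k\|f\|$ for all integers $k\ge 1$. Let $\operatorname{sinc}x=\frac{\sin\pi x}{\pi x}$ for $x\ne 0$, $\operatorname{sinc}0=1$, and for integers $m\ge 1$ and $k$ put $$A_{m,k}=(-1)^{k+1}\operatorname{sinc}^{(2m-1)}\left(\tfrac12-k\right),\qquad B_{m,k}=(-1)^{k+1}\operatorname{sinc}^{(2m)}(-k)\ (k\neq 0),\qquad B_{m,0}=(-1)^{m+1}\frac{\pi^{2m}}{2m+1}.$$ For $\sigma>0$, $m\ge 1$ and $f\in E$ define $$\mathcal{B}_D^{(2m-1)}(\sigma)f=\left(\frac{\sigma}{\pi}\right)^{2m-1}\sum_{k\in\mathbb{Z}}(-1)^{k+1}A_{m,k}\,e^{\frac{\pi}{\sigma}(k-\frac12)D}f,\qquad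 \mathcal{B}_D^{(2m)}(\sigma)f=\left(\frac{\sigma}{\pi}\right)^{2m}\sum_{k\in\mathbb{Z}}(-1)^{k+1}B_{m,k}\,e^{\frac{\pi k}{\sigma}D}f .$$ **Theorem.** Let $\sigma>0$ and let $r\ge 1$ be an integer. The series defining $\mathcal{B}_D^{(r)}(\sigma)f$ converges (unconditionally) in the norm of $E$ for every $f\in E$, and $\mathcal{B}_D^{(r)}(\sigma)$ is a bounded linear operator on $E$ with $\|\mathcal{B}_D^{(r)}(\sigma)\|\le\sigma^r$. For every $f\in\mathbf{B}_\sigma(D)$, $$D^rf=\mathcal{B}_D^{(r)}(\sigma)f .$$ Moreover, for such $f$, the series obtained by applying $e^{tD}$ to each term of $\mathcal{B}_D^{(r)}(\sigma)f$, that is, the series with each $e^{sD}f$ replaced by $e^{(t+s)D}f$, converges to $e^{tD}D^rf$ in the norm of $E$, uniformly in $t\in\mathbb{R}$. -/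

import Mathlib

open Filter Topology

/-- A strongly continuous one-parameter group of linear isometries `t ↦ T t`, `t ∈ ℝ`, on a normed
space `E`. -/
structure IsometryGroup (𝕜 E : Type*) [RCLike 𝕜] [NormedAddCommGroup E] [NormedSpace 𝕜 E] where
  /-- the operator `T t = e^{tD}` -/
  op : ℝ → E →L[𝕜] E
  op_zero : op 0 = ContinuousLinearMap.id 𝕜 E
  op_add : ∀ s t : ℝ, op (s + t) = (op s).comp (op t)
  norm_op_apply : ∀ (t : ℝ) (f : E), ‖op t f‖ = ‖f‖
  continuous_op_apply : ∀ f : E, Continuous fun t : ℝ => op t f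

namespace LinearPMap

variable {𝕜 E : Type*} [RCLike 𝕜] [NormedAddCommGroup E] [NormedSpace 𝕜 E]

/-- The product `B A` of unbounded operators on its natural domain
`{f ∈ dom A | A f ∈ dom B}`. -/
noncomputable def prodOp (B A : E →ₗ.[𝕜] E) : E →ₗ.[𝕜] E where
  domain := (B.domain.comap A.toFun).map A.domain.subtype
  toFun :=
    { toFun := fun f =>
        B ⟨A ⟨f.1, by obtain ⟨g, -, hg⟩ := f.2; exact hg ▸ g.2⟩, by
          obtain ⟨f, ⟨g, hg, rfl⟩⟩ := f; exact hg⟩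
      map_add' := fun f g => by
        rw [← B.map_add]
        congr 1
        apply Subtype.ext
        simp only [Submodule.coe_add]
        rw [← A.map_add]
        rfl
      map_smul' := fun c f => by
        rw [RingHom.id_apply, ← B.map_smul]
        congr 1
        apply Subtype.ext
        simp only [Submodule.coe_smul]
        rw [← A.map_smul]
        rfl }

/-- The powers `D ^ k` of an unbounded operator, with
`dom D ^ (k + 1) = {f ∈ dom D ^ k | D ^ k f ∈ dom D}`. -/
noncomputable def powOp (D : E →ₗ.[𝕜] E) : ℕ → (E →ₗ.[𝕜] E)
  | 0 => (LinearMap.id : E →ₗ[𝕜] E).toPMap ⊤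
  | k + 1 => D.prodOp (D.powOp k)

/-- The graph of the product is the composition of the graphs. -/
theorem mem_graph_prodOp (B A : E →ₗ.[𝕜] E) (x z : E) :
    (x, z) ∈ (B.prodOp A).graph ↔ ∃ y, (x, y) ∈ A.graph ∧ (y, z) ∈ B.graph := by
  simp only [mem_graph_iff]
  constructor
  · rintro ⟨⟨f, ⟨g, hg, rfl⟩⟩, rfl, rfl⟩
    exact ⟨A g, ⟨g, rfl, rfl⟩, ⟨⟨A g, hg⟩, rfl, rfl⟩⟩
  · rintro ⟨y, ⟨f, rfl, rfl⟩, ⟨g, hg, rfl⟩⟩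
    have hd : A f ∈ B.domain := hg ▸ g.2
    refine ⟨⟨f.1, ⟨f, hd, rfl⟩⟩, rfl, ?_⟩
    have : g = ⟨A f, hd⟩ := Subtype.ext hg
    rw [this]
    rfl

end LinearPMap

/-- The Bernstein space `B_σ(D)`: vectors `f` in the domain of all the powers of `D` with
`‖D ^ k f‖ ≤ σ ^ k ‖f‖`. -/
def bernsteinSpace {𝕜 E : Type*} [RCLike 𝕜] [NormedAddCommGroup E] [NormedSpace 𝕜 E]
    (D : E →ₗ.[𝕜] E) (σ : ℝ) : Set E :=
  {f | ∀ k : ℕ, ∃ h : f ∈ (D.powOp k).domain, ‖D.powOp k ⟨f, h⟩‖ ≤ σ ^ k * ‖f‖}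

/-- `sinc x = sin (π x) / (π x)`, with `sinc 0 = 1`. -/
noncomputable def sincPi (x : ℝ) : ℝ := Real.sinc (Real.pi * x)

/-- `A_{m,k} = (-1)^{k+1} sinc^{(2m-1)}(1/2 - k)`, for `m ≥ 1`. -/
noncomputable def boasA (m : ℕ) (k : ℤ) : ℝ :=
  (-1) ^ (k + 1) * iteratedDeriv (2 * m - 1) sincPi (1 / 2 - k)

/-- `B_{m,k} = (-1)^{k+1} sinc^{(2m)}(-k)` for `k ≠ 0`, and
`B_{m,0} = (-1)^{m+1} π^{2m} / (2m+1)`, for `m ≥ 1`. -/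
noncomputable def boasB (m : ℕ) (k : ℤ) : ℝ :=
  if k = 0 then (-1) ^ (m + 1) * Real.pi ^ (2 * m) / (2 * m + 1)
  else (-1) ^ (k + 1) * iteratedDeriv (2 * m) sincPi (-k)

/-- The coefficient of the `k`-th shift in the operator of order `r ≥ 1`:
`(σ/π)^r (-1)^{k+1} A_{m,k}` if `r = 2m - 1`, and `(σ/π)^r (-1)^{k+1} B_{m,k}` if `r = 2m`. -/
noncomputable def boasCoeff (σ : ℝ) (r : ℕ) (k : ℤ) : ℝ :=
  if Odd r then (σ / Real.pi) ^ r * ((-1) ^ (k + 1) * boasA ((r + 1) / 2) k)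
  else (σ / Real.pi) ^ r * ((-1) ^ (k + 1) * boasB (r / 2) k)

/-- The `k`-th shift in the operator of order `r`: `(π/σ)(k - 1/2)` if `r` is odd, and `π k / σ`
if `r` is even. -/
noncomputable def boasNode (σ : ℝ) (r : ℕ) (k : ℤ) : ℝ :=
  if Odd r then Real.pi / σ * (k - 1 / 2) else Real.pi * k / σ

theorem boasCoeff_odd (σ : ℝ) (m : ℕ) (hm : 1 ≤ m) (k : ℤ) :
    boasCoeff σ (2 * m - 1) k =
      (σ / Real.pi) ^ (2 * m - 1) * ((-1) ^ (k + 1) * boasA m k) := by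
  have h1 : Odd (2 * m - 1) := ⟨m - 1, by omega⟩
  have h2 : (2 * m - 1 + 1) / 2 = m := by omega
  rw [boasCoeff, if_pos h1, h2]

theorem boasCoeff_even (σ : ℝ) (m : ℕ) (k : ℤ) :
    boasCoeff σ (2 * m) k = (σ / Real.pi) ^ (2 * m) * ((-1) ^ (k + 1) * boasB m k) := by
  have h1 : ¬ Odd (2 * m) := by simp
  have h2 : 2 * m / 2 = m := by omega
  rw [boasCoeff, if_neg h1, h2]

namespace IsometryGroup

variable {𝕜 E : Type*} [RCLike 𝕜] [NormedAddCommGroup E] [NormedSpace 𝕜 E]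

/-- `g` is the derivative at `t = 0` of the orbit `t ↦ T t f`. -/
def HasGenerator (T : IsometryGroup 𝕜 E) (f g : E) : Prop :=
  Tendsto (fun t : ℝ => ((t⁻¹ : ℝ) : 𝕜) • (T.op t f - f)) (𝓝[≠] 0) (𝓝 g)

theorem HasGenerator.add {T : IsometryGroup 𝕜 E} {f g f' g' : E} (h : T.HasGenerator f g)
    (h' : T.HasGenerator f' g') : T.HasGenerator (f + f') (g + g') := by
  refine (Tendsto.add h h').congr fun t => ?_
  rw [← smul_add, map_add]
  congr 1
  abel

theorem HasGenerator.smul {T : IsometryGroup 𝕜 E} {f g : E} (c : 𝕜) (h : T.HasGenerator f g) :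
    T.HasGenerator (c • f) (c • g) := by
  refine (Tendsto.const_smul h c).congr fun t => ?_
  rw [smul_comm, map_smul, smul_sub]

theorem HasGenerator.unique {T : IsometryGroup 𝕜 E} {f g g' : E} (h : T.HasGenerator f g)
    (h' : T.HasGenerator f g') : g = g' :=
  tendsto_nhds_unique h h'

/-- The infinitesimal generator `D f = lim_{t → 0} (T t f - f) / t`, on the domain where this limit
exists. -/
noncomputable def generator (T : IsometryGroup 𝕜 E) : E →ₗ.[𝕜] E where
  domain :=
    { carrier := {f | ∃ g, T.HasGenerator f g}
      add_mem' := fun ⟨g, hg⟩ ⟨g', hg'⟩ => ⟨g + g', hg.add hg'⟩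
      zero_mem' := ⟨0, by simp [HasGenerator]⟩
      smul_mem' := fun c _ ⟨g, hg⟩ => ⟨c • g, hg.smul c⟩ }
  toFun :=
    { toFun := fun f => f.2.choose
      map_add' := fun f g =>
        (f + g).2.choose_spec.unique (f.2.choose_spec.add g.2.choose_spec)
      map_smul' := fun c f => (c • f).2.choose_spec.unique (f.2.choose_spec.smul c) }

theorem mem_graph_generator (T : IsometryGroup 𝕜 E) (f g : E) :
    (f, g) ∈ T.generator.graph ↔ T.HasGenerator f g := by
  rw [LinearPMap.mem_graph_iff]
  constructor
  · rintro ⟨f, rfl, rfl⟩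
    exact f.2.choose_spec
  · intro h
    exact ⟨⟨f, g, h⟩, rfl, HasGenerator.unique (Exists.choose_spec (⟨g, h⟩ : ∃ g, _)) h⟩

/-- The operator of order `r ≥ 1` given by the series of shifts
`(σ/π)^r ∑_{k ∈ ℤ} (-1)^{k+1} A_{m,k} e^{(π/σ)(k-1/2)D} f` if `r = 2m - 1`, and
`(σ/π)^r ∑_{k ∈ ℤ} (-1)^{k+1} B_{m,k} e^{(πk/σ)D} f` if `r = 2m`. -/
noncomputable def boasOp (T : IsometryGroup 𝕜 E) (σ : ℝ) (r : ℕ) (f : E) : E :=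
  ∑' k : ℤ, (boasCoeff σ r k : 𝕜) • T.op (boasNode σ r k) f

end IsometryGroup

/-! All coefficients have the form `(σ/π)^r · π^r sinc⁽ʳ⁾(π(s - k))` with the unnormalised `sinc`
and `s = 1/2` or `0` according to the parity of `r`. They are the Fourier coefficients, on `[-1,
1]`, of `e^{iπsu} (iπu)^r`; the twist by `s` makes this function continuous on the circle.
Substituting `u = 1 - v` in `sinc⁽ʳ⁾(x) = ∫₀¹ uʳ cos(xu + rπ/2) du` pulls out the sign
`(-1)^{⌈r/2⌉-k}` and leaves a nonnegative integral of size `O(k⁻²)`. The Fourier series therefore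
converges absolutely, and at `u = 1` all its terms have the same phase, so the absolute values of
the coefficients sum to exactly `σ^r`. This gives convergence of the operator series and its norm
bound (`hasSum_boasWeight_mul_exp`, `hasSum_abs_boasWeight`).

The Fourier series is the identity `D^r f = B f` for exponentials with frequency in `[-σ, σ]`.
Superposition extends it to functions whose Fourier transform is supported there, and damping by a
dilated `sinc²` extends it to bounded functions with `‖F⁽ᵏ⁾‖ ≤ M σ^k`
(`iteratedDeriv_eq_tsum_boasCoeff`). For `f` in the Bernstein space this applies to each orbit
function `t ↦ φ(e^{tD} f)`, and continuous functionals `φ` separate points. Uniformity in `t` holds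
because `e^{tD}` is an isometry. -/

open MeasureTheory

/-! ### Derivatives of sinc and their decay. -/

/-- The integral `∫₀¹ uʲ cos⁽ʲ⁾(x u) du`, which is the `j`-th derivative of `Real.sinc` at `x`. -/
noncomputable def sincIntegral (j : ℕ) (x : ℝ) : ℝ :=
  ∫ u in (0 : ℝ)..1, u ^ j * Real.cos (x * u + j * (Real.pi / 2))

theorem sincIntegral_zero : sincIntegral 0 = Real.sinc := by
  funext x
  by_cases hx : x = 0
  · simp [sincIntegral, hx]
  · simp [sincIntegral, Real.sinc_of_ne_zero hx, intervalIntegral.integral_comp_mul_left _ hx,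
      div_eq_inv_mul]

theorem hasDerivAt_sincIntegral (j : ℕ) (x : ℝ) :
    HasDerivAt (sincIntegral j) (sincIntegral (j + 1) x) x := by
  refine (intervalIntegral.hasDerivAt_integral_of_dominated_loc_of_deriv_le
    (F := fun x u => u ^ j * Real.cos (x * u + j * (Real.pi / 2)))
    (F' := fun x u => u ^ (j + 1) * Real.cos (x * u + (j + 1 : ℕ) * (Real.pi / 2)))
    (bound := fun u => |u| ^ (j + 1)) Filter.univ_mem ?_ ?_ ?_ ?_ ?_ ?_).2
  · exact Filter.Eventually.of_forall fun y =>
      (Continuous.aestronglyMeasurable (by fun_prop))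
  · exact Continuous.intervalIntegrable (by fun_prop) _ _
  · exact Continuous.aestronglyMeasurable (by fun_prop)
  · refine Filter.Eventually.of_forall fun u _ y _ => ?_
    rw [norm_mul, norm_pow, Real.norm_eq_abs]
    exact mul_le_of_le_one_right (by positivity) (Real.abs_cos_le_one _)
  · exact Continuous.intervalIntegrable (by fun_prop) _ _
  · refine Filter.Eventually.of_forall fun u _ y _ => ?_
    have h : HasDerivAt (fun y : ℝ => y * u + j * (Real.pi / 2)) u y := by
      simpa using ((hasDerivAt_id y).mul_const u).add_const (j * (Real.pi / 2))
    convert! (h.cos.const_mul (u ^ j)) using 1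
    have : y * u + ((j + 1 : ℕ) : ℝ) * (Real.pi / 2) =
        (y * u + j * (Real.pi / 2)) + Real.pi / 2 := by push_cast; ring
    rw [this, Real.cos_add_pi_div_two]
    ring

theorem iteratedDeriv_sinc (j : ℕ) : iteratedDeriv j Real.sinc = sincIntegral j := by
  induction j with
  | zero => rw [iteratedDeriv_zero, sincIntegral_zero]
  | succ j ih =>
    rw [iteratedDeriv_succ, ih]
    exact funext fun x => (hasDerivAt_sincIntegral j x).deriv

theorem contDiff_sinc (n : ℕ∞) : ContDiff ℝ n Real.sinc :=
  contDiff_of_differentiable_iteratedDeriv fun m _ => by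
    rw [iteratedDeriv_sinc]
    exact fun x => (hasDerivAt_sincIntegral m x).differentiableAt

theorem iteratedDeriv_sincPi (r : ℕ) (x : ℝ) :
    iteratedDeriv r sincPi x = Real.pi ^ r * sincIntegral r (Real.pi * x) := by
  have h := iteratedDeriv_comp_const_mul (n := r) (contDiff_sinc r) Real.pi
  rw [iteratedDeriv_sinc] at h
  exact congrFun h x

theorem abs_sincIntegral_le_one (j : ℕ) (x : ℝ) : |sincIntegral j x| ≤ 1 := by
  have h := intervalIntegral.norm_integral_le_of_norm_le_const (a := (0 : ℝ)) (b := 1) (C := 1)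
    (f := fun u => u ^ j * Real.cos (x * u + j * (Real.pi / 2))) fun u hu => by
      rw [Set.uIoc_of_le zero_le_one] at hu
      rw [norm_mul, norm_pow]
      refine mul_le_one₀ (pow_le_one₀ (norm_nonneg _) ?_) (norm_nonneg _) (Real.abs_cos_le_one _)
      rw [Real.norm_eq_abs, abs_of_pos hu.1]
      exact hu.2
  simpa [sincIntegral] using h

/-- Integration by parts, for the `O(1/x)` decay of the derivatives. The boundary term at `u = 0`
vanishes through the power if `j > 0` and through the sine if `j = 0`. -/
theorem mul_sincIntegral (j : ℕ) (x : ℝ) :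
    x * sincIntegral j x = Real.sin (x + j * (Real.pi / 2)) -
      ∫ u in (0 : ℝ)..1, (j * u ^ (j - 1)) * Real.sin (x * u + j * (Real.pi / 2)) := by
  have hd : ∀ u : ℝ, HasDerivAt (fun u : ℝ => u ^ j * Real.sin (x * u + j * (Real.pi / 2)))
      ((j * u ^ (j - 1)) * Real.sin (x * u + j * (Real.pi / 2)) +
        x * (u ^ j * Real.cos (x * u + j * (Real.pi / 2)))) u := fun u => by
    have h : HasDerivAt (fun u : ℝ => x * u + j * (Real.pi / 2)) x u := by
      simpa using ((hasDerivAt_id u).const_mul x).add_const (j * (Real.pi / 2))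
    convert! (hasDerivAt_pow j u).mul h.sin using 1
    ring
  have h := intervalIntegral.integral_eq_sub_of_hasDerivAt (a := (0 : ℝ)) (b := 1)
    (fun u _ => hd u) (Continuous.intervalIntegrable (by fun_prop) _ _)
  rw [intervalIntegral.integral_add (Continuous.intervalIntegrable (by fun_prop) _ _)
    (Continuous.intervalIntegrable (by fun_prop) _ _), intervalIntegral.integral_const_mul] at h
  have h0 : (0 : ℝ) ^ j * Real.sin (x * 0 + j * (Real.pi / 2)) = 0 := by
    rcases j with _ | j <;> simp
  rw [h0, one_pow, one_mul, mul_one, sub_zero] at h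
  rw [← h, sincIntegral]
  ring

theorem abs_mul_sincIntegral_le (j : ℕ) (x : ℝ) : |x * sincIntegral j x| ≤ 2 := by
  have h1 : |∫ u in (0 : ℝ)..1, (j * u ^ (j - 1)) * Real.sin (x * u + j * (Real.pi / 2))| ≤ 1 := by
    have h2 : ∫ u in (0 : ℝ)..1, (j : ℝ) * u ^ (j - 1) ≤ 1 := by
      rw [intervalIntegral.integral_const_mul, integral_pow]
      rcases j with _ | j
      · simp
      · have : ((j : ℝ) + 1) ≠ 0 := by positivity
        simp [this]
    refine (intervalIntegral.norm_integral_le_of_norm_le (μ := volume)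
      (f := fun u : ℝ => (j * u ^ (j - 1)) * Real.sin (x * u + j * (Real.pi / 2)))
      (g := fun u : ℝ => (j : ℝ) * u ^ (j - 1)) zero_le_one
      (Filter.Eventually.of_forall fun u hu => ?_)
      (Continuous.intervalIntegrable (by fun_prop) _ _)).trans h2
    have hu0 : 0 ≤ u := hu.1.le
    rw [norm_mul, Real.norm_of_nonneg (by positivity)]
    exact mul_le_of_le_one_right (by positivity) (Real.abs_sin_le_one _)
  rw [mul_sincIntegral]
  exact (abs_sub _ _).trans (by linarith [Real.abs_sin_le_one (x + j * (Real.pi / 2))])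

/-- The constant is `1·1 + 2·2`, from the bounds `1` and `2/|x|` on each factor. -/
theorem abs_sincIntegral_mul_le (i j : ℕ) (x : ℝ) :
    |sincIntegral i x| * |sincIntegral j x| ≤ 5 * (1 + x ^ 2)⁻¹ := by
  rw [← div_eq_mul_inv, le_div_iff₀ (by positivity)]
  have h1 := mul_le_mul (abs_sincIntegral_le_one i x) (abs_sincIntegral_le_one j x)
    (abs_nonneg _) zero_le_one
  have h2 := mul_le_mul (abs_mul_sincIntegral_le i x) (abs_mul_sincIntegral_le j x)
    (abs_nonneg _) zero_le_two
  rw [abs_mul, abs_mul] at h2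
  nlinarith [sq_abs x]

/-! ### Sign and summability of the coefficients. -/

/-- The offset of the nodes: `0` for even `r` and `1/2` for odd `r`. -/
noncomputable def boasShift (r : ℕ) : ℝ := ((r + 1) / 2 : ℕ) - (r : ℝ) / 2

/-- The coefficients for `σ = π`. -/
noncomputable def boasWeight (r : ℕ) (k : ℤ) : ℝ :=
  Real.pi ^ r * sincIntegral r (Real.pi * (boasShift r - k))

/-- After `u = 1 - v` the constant part of the phase is `π(s + r/2 - k)`, and `s + r/2 = ⌈r/2⌉` is
an integer, so it contributes only a sign. -/
theorem sincIntegral_pi_mul_shift (r : ℕ) (k : ℤ) :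
    sincIntegral r (Real.pi * (boasShift r - k)) = (-1) ^ (((r + 1) / 2 : ℕ) - k : ℤ) *
      ∫ v in (0 : ℝ)..1, (1 - v) ^ r * Real.cos (Real.pi * (k - boasShift r) * v) := by
  have h := intervalIntegral.integral_comp_sub_left (a := 0) (b := 1)
    (fun u => u ^ r * Real.cos (Real.pi * (boasShift r - k) * u + r * (Real.pi / 2))) (1 : ℝ)
  rw [sub_self, sub_zero] at h
  rw [sincIntegral, ← h, ← intervalIntegral.integral_const_mul]
  congr 1
  funext v
  have : Real.pi * (boasShift r - k) * (1 - v) + r * (Real.pi / 2) =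
      Real.pi * (k - boasShift r) * v + ((((r + 1) / 2 : ℕ) - k : ℤ) : ℝ) * Real.pi := by
    rw [boasShift, Int.cast_sub, Int.cast_natCast]
    ring
  rw [this, Real.cos_add_int_mul_pi]
  ring

/-- Two integrations by parts, with `1 - cos` chosen as the antiderivative so that every term on the
right is nonnegative. The boundary term at `v = 1` survives only for `p = 0`, hence the factor `0 ^
p`. -/
theorem sq_mul_integral_one_sub_pow_mul_cos (p : ℕ) (l : ℝ) :
    l ^ 2 * ∫ v in (0 : ℝ)..1, (1 - v) ^ (p + 1) * Real.cos (l * v) =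
      (p + 1) * 0 ^ p * (1 - Real.cos l) +
        ∫ v in (0 : ℝ)..1, ((p + 1) * p * (1 - v) ^ (p - 1)) * (1 - Real.cos (l * v)) := by
  have hd : ∀ v : ℝ, HasDerivAt (fun v : ℝ => l * (1 - v) ^ (p + 1) * Real.sin (l * v) +
      (p + 1) * (1 - v) ^ p * (1 - Real.cos (l * v)))
      (l ^ 2 * ((1 - v) ^ (p + 1) * Real.cos (l * v)) -
        ((p + 1) * p * (1 - v) ^ (p - 1)) * (1 - Real.cos (l * v))) v := fun v => by
    have h : HasDerivAt (fun v : ℝ => l * v) l v := by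
      simpa using (hasDerivAt_id v).const_mul l
    have h1 : HasDerivAt (fun v : ℝ => 1 - v) (-1) v := (hasDerivAt_id v).const_sub 1
    convert! (((h1.pow (p + 1)).const_mul l).mul h.sin).add
      (((h1.pow p).const_mul ((p : ℝ) + 1)).mul (h.cos.const_sub 1)) using 1
    simp only [Pi.pow_apply, Nat.add_sub_cancel]
    push_cast
    ring
  have h := intervalIntegral.integral_eq_sub_of_hasDerivAt (a := (0 : ℝ)) (b := 1)
    (fun u _ => hd u) (Continuous.intervalIntegrable (by fun_prop) _ _)
  rw [intervalIntegral.integral_sub (Continuous.intervalIntegrable (by fun_prop) _ _)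
    (Continuous.intervalIntegrable (by fun_prop) _ _), intervalIntegral.integral_const_mul] at h
  simp only [sub_self, mul_zero, Real.sin_zero, Real.cos_zero, mul_one, zero_mul, ne_eq,
    Nat.add_eq_zero_iff, one_ne_zero, and_false, not_false_eq_true, zero_pow, zero_add, add_zero,
    sub_zero] at h
  linarith

theorem integral_one_sub_pow_mul_cos_nonneg (p : ℕ) (l : ℝ) :
    0 ≤ ∫ v in (0 : ℝ)..1, (1 - v) ^ (p + 1) * Real.cos (l * v) := by
  by_cases hl : l = 0
  · refine intervalIntegral.integral_nonneg zero_le_one fun v hv => ?_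
    have : 0 ≤ 1 - v := by linarith [hv.2]
    simp only [hl, zero_mul, Real.cos_zero]
    positivity
  · refine (mul_nonneg_iff_of_pos_left (by positivity : 0 < l ^ 2)).1 ?_
    rw [sq_mul_integral_one_sub_pow_mul_cos]
    refine add_nonneg (mul_nonneg (by positivity) (by linarith [Real.cos_le_one l])) ?_
    refine intervalIntegral.integral_nonneg zero_le_one fun v hv => ?_
    have : 0 ≤ 1 - v := by linarith [hv.2]
    exact mul_nonneg (by positivity) (by linarith [Real.cos_le_one (l * v)])

theorem integral_one_sub_pow_mul_cos_le (p : ℕ) (l : ℝ) :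
    (1 + l ^ 2) * ∫ v in (0 : ℝ)..1, (1 - v) ^ (p + 1) * Real.cos (l * v) ≤
      1 + 2 * (p + 1) ^ 2 := by
  have h1 : ∫ v in (0 : ℝ)..1, (1 - v) ^ (p + 1) * Real.cos (l * v) ≤ 1 := by
    refine (le_abs_self _).trans ?_
    have h := intervalIntegral.norm_integral_le_of_norm_le_const (a := (0 : ℝ)) (b := 1) (C := 1)
      (f := fun v => (1 - v) ^ (p + 1) * Real.cos (l * v)) fun v hv => by
        rw [Set.uIoc_of_le zero_le_one] at hv
        rw [norm_mul, norm_pow]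
        refine mul_le_one₀ (pow_le_one₀ (norm_nonneg _) ?_) (norm_nonneg _)
          (Real.abs_cos_le_one _)
        rw [Real.norm_eq_abs, abs_le]
        constructor <;> linarith [hv.1, hv.2]
    simpa using h
  have h2 : ∫ v in (0 : ℝ)..1, ((p + 1) * p * (1 - v) ^ (p - 1)) * (1 - Real.cos (l * v)) ≤
      (p + 1) * p * 2 := by
    refine (le_abs_self _).trans ?_
    have h := intervalIntegral.norm_integral_le_of_norm_le_const (a := (0 : ℝ)) (b := 1)
      (C := (p + 1) * p * 2)
      (f := fun v => ((p + 1) * p * (1 - v) ^ (p - 1)) * (1 - Real.cos (l * v))) fun v hv => by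
        rw [Set.uIoc_of_le zero_le_one] at hv
        have h0 : 0 ≤ 1 - v := by linarith [hv.2]
        have h3 : (1 - v) ^ (p - 1) ≤ 1 := pow_le_one₀ h0 (by linarith [hv.1])
        have h4 := Real.cos_le_one (l * v)
        have h5 := Real.neg_one_le_cos (l * v)
        rw [Real.norm_of_nonneg (mul_nonneg (by positivity) (by linarith))]
        refine mul_le_mul ?_ (by linarith) (by linarith) (by positivity)
        exact mul_le_of_le_one_right (by positivity) h3
    simpa using h
  have h3 : ((p : ℝ) + 1) * 0 ^ p * (1 - Real.cos l) ≤ (p + 1) * 2 := by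
    have h0 : ((p : ℝ) + 1) * 0 ^ p ≤ p + 1 :=
      mul_le_of_le_one_right (by positivity) (pow_le_one₀ le_rfl zero_le_one)
    exact mul_le_mul h0 (by linarith [Real.neg_one_le_cos l]) (by linarith [Real.cos_le_one l])
      (by positivity)
  rw [add_mul, sq_mul_integral_one_sub_pow_mul_cos]
  linarith

theorem abs_boasWeight {r : ℕ} (hr : 1 ≤ r) (k : ℤ) :
    |boasWeight r k| = (-1) ^ (((r + 1) / 2 : ℕ) - k : ℤ) * boasWeight r k := by
  obtain ⟨p, rfl⟩ : ∃ p, r = p + 1 := ⟨r - 1, by omega⟩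
  have h := integral_one_sub_pow_mul_cos_nonneg p (Real.pi * (k - boasShift (p + 1)))
  rw [boasWeight, sincIntegral_pi_mul_shift]
  have h1 : (-1 : ℝ) ^ (((p + 1 + 1) / 2 : ℕ) - k : ℤ) = 1 ∨
      (-1 : ℝ) ^ (((p + 1 + 1) / 2 : ℕ) - k : ℤ) = -1 := by
    rw [neg_one_zpow_eq_ite]
    split_ifs <;> simp
  rcases h1 with h1 | h1 <;> rw [h1]
  · rw [one_mul, one_mul, abs_of_nonneg (by positivity)]
  · rw [neg_one_mul, neg_one_mul, mul_neg, abs_neg, neg_neg, abs_of_nonneg (by positivity)]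

theorem boasShift_eq_ite (r : ℕ) : boasShift r = if Odd r then 1 / 2 else 0 := by
  rw [boasShift]
  split_ifs with h
  · obtain ⟨m, rfl⟩ := h
    have : (2 * m + 1 + 1) / 2 = m + 1 := by omega
    rw [this]
    push_cast
    ring
  · obtain ⟨m, rfl⟩ := Nat.not_odd_iff_even.1 h
    have : (m + m + 1) / 2 = m := by omega
    rw [this]
    push_cast
    ring

theorem summable_boasWeight {r : ℕ} (hr : 1 ≤ r) : Summable (boasWeight r) := by
  obtain ⟨p, rfl⟩ : ∃ p, r = p + 1 := ⟨r - 1, by omega⟩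
  -- The offset `1/4` keeps the denominators away from zero for both values of the shift.
  have hs := (Real.summable_one_div_int_add_rpow (1 / 4 - boasShift (p + 1)) 2).2 (by norm_num)
  refine Summable.of_norm_bounded
    (hs.mul_left (Real.pi ^ (p + 1) * ((1 + 2 * ((p : ℝ) + 1) ^ 2) * 2))) fun k => ?_
  have h0 := integral_one_sub_pow_mul_cos_nonneg p (Real.pi * (k - boasShift (p + 1)))
  have h1 := integral_one_sub_pow_mul_cos_le p (Real.pi * (k - boasShift (p + 1)))
  rw [boasWeight, sincIntegral_pi_mul_shift, norm_mul, norm_mul, norm_zpow, norm_neg, norm_one,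
    one_zpow, one_mul, Real.norm_of_nonneg h0, Real.norm_of_nonneg (by positivity), mul_assoc]
  refine mul_le_mul_of_nonneg_left ?_ (by positivity)
  generalize (∫ v in (0 : ℝ)..1, (1 - v) ^ (p + 1) *
    Real.cos (Real.pi * (k - boasShift (p + 1)) * v)) = J at h0 h1
  have hx : (k : ℝ) + (1 / 4 - boasShift (p + 1)) ≠ 0 := by
    rw [boasShift_eq_ite]
    intro h
    split_ifs at h
    · have h2 : ((4 * k - 1 : ℤ) : ℝ) = 0 := by push_cast; linarith
      have h3 : 4 * k - 1 = 0 := by exact_mod_cast h2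
      omega
    · have h2 : ((4 * k + 1 : ℤ) : ℝ) = 0 := by push_cast; linarith
      have h3 : 4 * k + 1 = 0 := by exact_mod_cast h2
      omega
  rw [Real.rpow_two, sq_abs, mul_one_div, le_div_iff₀ (by positivity)]
  have h4 : ((k : ℝ) + (1 / 4 - boasShift (p + 1))) ^ 2 ≤
      2 * (1 + (Real.pi * (k - boasShift (p + 1))) ^ 2) := by
    have h5 : (1 : ℝ) ≤ Real.pi ^ 2 := one_le_pow₀ (by linarith [Real.pi_gt_three])
    rw [mul_pow]
    generalize (k : ℝ) = y
    nlinarith [sq_nonneg (y - boasShift (p + 1) - 1 / 4),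
      mul_le_mul_of_nonneg_right h5 (sq_nonneg (y - boasShift (p + 1)))]
  nlinarith [mul_le_mul_of_nonneg_left h4 h0]

/-! ### Fourier expansion of the symbol and the sum of absolute values. -/

theorem integral_exp_mul_pow (r : ℕ) (x : ℝ) :
    ∫ u in (-1 : ℝ)..1, Complex.exp (-(Complex.I * Real.pi * x * u)) *
      (Complex.I * Real.pi * u) ^ r = 2 * (Real.pi ^ r * sincIntegral r (-(Real.pi * x)) : ℝ) := by
  have hc : Continuous fun u : ℝ => Complex.exp (-(Complex.I * Real.pi * x * u)) *
      (Complex.I * Real.pi * u) ^ r := by fun_prop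
  -- Pairing `u` with `-u` and writing `(±i)^r = e^{±irπ/2}` turns the integrand into twice a cosine
  -- with phase `rπ/2`.
  rw [← intervalIntegral.integral_add_adjacent_intervals (b := 0)
    (hc.intervalIntegrable _ _) (hc.intervalIntegrable _ _)]
  have h := intervalIntegral.integral_comp_neg (a := 0) (b := 1)
    (fun u : ℝ => Complex.exp (-(Complex.I * Real.pi * x * u)) * (Complex.I * Real.pi * u) ^ r)
  rw [neg_zero] at h
  rw [← h, ← intervalIntegral.integral_add (Continuous.intervalIntegrable (by fun_prop) _ _)
    (hc.intervalIntegrable _ _), sincIntegral, ← intervalIntegral.integral_const_mul,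
    ← intervalIntegral.integral_ofReal, ← intervalIntegral.integral_const_mul]
  congr 1
  funext u
  have hI : ∀ n : ℕ, Complex.I ^ n = Complex.exp (n * (Real.pi / 2) * Complex.I) := fun n => by
    rw [mul_assoc, Complex.exp_nat_mul, Complex.exp_pi_div_two_mul_I]
  have hI' : ∀ n : ℕ, (-Complex.I) ^ n = Complex.exp (-(n * (Real.pi / 2) * Complex.I)) :=
    fun n => by
    rw [← Complex.inv_I, inv_pow, hI, Complex.exp_neg]
  have h1 : Complex.I * Real.pi * ((-u : ℝ) : ℂ) = -Complex.I * (Real.pi * u) := by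
    push_cast
    ring
  have h2 : Complex.exp (((-(Real.pi * x) * u + r * (Real.pi / 2) : ℝ) : ℂ) * Complex.I) =
      Complex.exp (-(Complex.I * Real.pi * x * u)) *
        Complex.exp (r * (Real.pi / 2) * Complex.I) := by
    rw [← Complex.exp_add]
    push_cast
    ring_nf
  have h3 : Complex.exp (-((-(Real.pi * x) * u + r * (Real.pi / 2) : ℝ) : ℂ) * Complex.I) =
      Complex.exp (-(Complex.I * Real.pi * x * (-u : ℝ))) *
        Complex.exp (-(r * (Real.pi / 2) * Complex.I)) := by
    rw [← Complex.exp_add]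
    push_cast
    ring_nf
  rw [h1, mul_assoc Complex.I (Real.pi : ℂ) (u : ℂ), mul_pow, mul_pow Complex.I, hI, hI',
    Complex.ofReal_mul, Complex.ofReal_mul, Complex.ofReal_cos, Complex.cos, h2, h3]
  push_cast
  ring

theorem hasSum_boasWeight_mul_exp {r : ℕ} (hr : 1 ≤ r) {u : ℝ} (hu : |u| ≤ 1) :
    HasSum (fun k : ℤ => (boasWeight r k : ℂ) *
      Complex.exp (Complex.I * Real.pi * (k - boasShift r) * u)) ((Complex.I * Real.pi * u) ^ r) := by
  have : Fact ((0 : ℝ) < 2) := ⟨two_pos⟩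
  let g : ℝ → ℂ := fun u => Complex.exp (Complex.I * Real.pi * boasShift r * u) *
    (Complex.I * Real.pi * u) ^ r
  have hg : Continuous g := by fun_prop
  have hper : g (-1) = g (-1 + 2) := by
    have h1 : Complex.exp (Complex.I * Real.pi * boasShift r * (1 : ℝ)) =
        Complex.exp (Complex.I * Real.pi * boasShift r * (-1 : ℝ)) * (-1) ^ r := by
      have h2 : (-1 : ℂ) ^ r = Complex.exp (r * (-(Real.pi * Complex.I))) := by
        rw [Complex.exp_nat_mul, Complex.exp_neg, Complex.exp_pi_mul_I, inv_neg, inv_one]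
      rw [h2, ← Complex.exp_add, Complex.exp_eq_exp_iff_exists_int]
      -- The two exponents differ by `2πi(s + r/2)`, and `s + r/2` is this integer.
      refine ⟨((r + 1) / 2 : ℕ), ?_⟩
      rw [boasShift, Int.cast_natCast]
      push_cast
      ring
    have h3 : (-1 + 2 : ℝ) = 1 := by norm_num
    simp only [g]
    rw [h3, h1]
    have h4 : Complex.I * Real.pi * ((-1 : ℝ) : ℂ) = (-1) * (Complex.I * Real.pi * (1 : ℝ)) := by
      push_cast
      ring
    rw [h4, mul_pow]
    ring
  let G : C(AddCircle (2 : ℝ), ℂ) := ⟨AddCircle.liftIco 2 (-1) g,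
    AddCircle.liftIco_continuous hper hg.continuousOn⟩
  have hcoeff : ∀ n : ℤ, fourierCoeff G n = (boasWeight r n : ℂ) := fun n => by
    refine (fourierCoeff_liftIco_eq (T := 2) (a := -1) g n).trans ?_
    have h1 := integral_exp_mul_pow r (n - boasShift r)
    have h2 : -(Real.pi * (n - boasShift r)) = Real.pi * (boasShift r - n) := by ring
    rw [h2, ← boasWeight] at h1
    have h3 : (-1 + 2 : ℝ) = 1 := by norm_num
    have h4 : ((1 : ℝ) / (-1 + 2 - -1)) = 1 / 2 := by norm_num
    rw [fourierCoeffOn_eq_integral, h4]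
    have h5 : ∫ x in (-1 : ℝ)..(-1 + 2), fourier (-n) (x : AddCircle ((-1 : ℝ) + 2 - -1)) • g x =
        2 * (boasWeight r n : ℂ) := by
      rw [← h1, h3]
      congr 1
      funext x
      simp only [g]
      rw [fourier_coe_apply, smul_eq_mul, ← mul_assoc, ← Complex.exp_add]
      congr 2
      push_cast
      ring
    rw [h5, Complex.real_smul]
    push_cast
    ring
  have hsum : Summable (fourierCoeff G) := by
    rw [funext hcoeff]
    exact Complex.ofRealCLM.summable (summable_boasWeight hr)
  have hGI : ∀ x ∈ Set.Ico (-1 : ℝ) (-1 + 2), G (x : AddCircle (2 : ℝ)) = g x := fun x hx =>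
    (AddCircle.liftIco_coe_apply hx : AddCircle.liftIco (2 : ℝ) (-1) g x = g x)
  have hG : G (u : AddCircle (2 : ℝ)) = g u := by
    -- The endpoint `u = 1` lies outside the half-open fundamental interval and is moved to `-1` by
    -- periodicity.
    by_cases h1 : u = 1
    · have h2 : (u : AddCircle (2 : ℝ)) = ((-1 : ℝ) : AddCircle (2 : ℝ)) := by
        rw [h1, ← AddCircle.coe_add_period 2 (-1)]
        norm_num
      have h3 : (-1 + 2 : ℝ) = u := by rw [h1]; norm_num
      rw [h2, ← h3, ← hper]
      exact hGI _ (by simp)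
    · have h2 := lt_of_le_of_ne (abs_le.1 hu).2 h1
      exact hGI _ ⟨(abs_le.1 hu).1, by linarith⟩
  have h := has_pointwise_sum_fourier_series_of_summable hsum u
  rw [hG] at h
  have h2 := h.mul_left (Complex.exp (-(Complex.I * Real.pi * boasShift r * u)))
  convert! h2 using 1
  · funext k
    rw [hcoeff, fourier_coe_apply, smul_eq_mul, mul_left_comm, ← Complex.exp_add]
    congr 2
    push_cast
    ring
  · simp only [g]
    rw [← mul_assoc, ← Complex.exp_add, neg_add_cancel, Complex.exp_zero, one_mul]

/-- At `u = 1` the exponential equals `i^r` times the sign of the `k`-th weight, so the Fourier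
series becomes the sum of absolute values. -/
theorem hasSum_abs_boasWeight {r : ℕ} (hr : 1 ≤ r) :
    HasSum (fun k : ℤ => |boasWeight r k|) (Real.pi ^ r) := by
  have h := (hasSum_boasWeight_mul_exp hr (u := 1) (by simp)).mul_left ((Complex.I ^ r)⁻¹)
  have hI : Complex.I ^ r ≠ 0 := pow_ne_zero _ Complex.I_ne_zero
  rw [Complex.ofReal_one, mul_one, mul_pow, inv_mul_cancel_left₀ hI] at h
  rw [← Complex.hasSum_ofReal]
  push_cast
  convert! h using 1
  funext k
  rw [abs_boasWeight hr]
  have h1 : Complex.exp (Complex.I * Real.pi * (k - boasShift r)) =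
      Complex.I ^ r * (-1) ^ (((r + 1) / 2 : ℕ) - k : ℤ) := by
    have h2 : (-1 : ℂ) ^ (((r + 1) / 2 : ℕ) - k : ℤ) =
        Complex.exp ((((r + 1) / 2 : ℕ) - k : ℤ) * (-(Real.pi * Complex.I))) := by
      rw [Complex.exp_int_mul, Complex.exp_neg, Complex.exp_pi_mul_I, inv_neg, inv_one]
    have h3 : Complex.I ^ r = Complex.exp (r * (Real.pi / 2 * Complex.I)) := by
      rw [Complex.exp_nat_mul, Complex.exp_pi_div_two_mul_I]
    rw [h2, h3, ← Complex.exp_add, boasShift, Int.cast_sub, Int.cast_natCast]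
    congr 1
    push_cast
    ring
  rw [mul_one, h1]
  push_cast
  field_simp

/-! ### Exponential type through derivative bounds. -/

open scoped FourierTransform ContDiff

/-- Leibniz and the binomial theorem: exponential types add under multiplication. -/
theorem norm_iteratedDeriv_mul_le_mul_add_pow {f g : ℝ → ℂ} (hf : ContDiff ℝ ∞ f)
    (hg : ContDiff ℝ ∞ g) {A B a b x : ℝ} (hA : 0 ≤ A) (ha : 0 ≤ a)
    (h1 : ∀ k : ℕ, ‖iteratedDeriv k f x‖ ≤ A * a ^ k)
    (h2 : ∀ k : ℕ, ‖iteratedDeriv k g x‖ ≤ B * b ^ k) (k : ℕ) :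
    ‖iteratedDeriv k (fun y => f y * g y) x‖ ≤ A * B * (a + b) ^ k := by
  simp only [← norm_iteratedFDeriv_eq_norm_iteratedDeriv] at h1 h2 ⊢
  refine (norm_iteratedFDeriv_mul_le hf hg x (by exact_mod_cast le_top)).trans ?_
  rw [add_pow, Finset.mul_sum]
  refine Finset.sum_le_sum fun i _ => ?_
  calc (k.choose i : ℝ) * ‖iteratedFDeriv ℝ i f x‖ * ‖iteratedFDeriv ℝ (k - i) g x‖
      ≤ (k.choose i : ℝ) * (A * a ^ i) * (B * b ^ (k - i)) := by
        refine mul_le_mul (mul_le_mul_of_nonneg_left (h1 i) (by positivity)) (h2 _)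
          (norm_nonneg _) (by positivity)
    _ = _ := by ring

theorem norm_iteratedDeriv_ofReal_sinc (j : ℕ) (x : ℝ) :
    ‖iteratedDeriv j (fun y : ℝ => (Real.sinc y : ℂ)) x‖ = |sincIntegral j x| := by
  have h := Complex.ofRealLI.norm_iteratedFDeriv_comp_left
    ((contDiff_sinc j).contDiffAt (x := x)) (i := j) le_rfl
  rw [norm_iteratedFDeriv_eq_norm_iteratedDeriv, norm_iteratedFDeriv_eq_norm_iteratedDeriv,
    iteratedDeriv_sinc, Real.norm_eq_abs] at h
  exact h

/-- The function `sinc²`, with complex values. -/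
noncomputable def sincSq (x : ℝ) : ℂ := (Real.sinc x : ℂ) * (Real.sinc x : ℂ)

theorem contDiff_sincSq : ContDiff ℝ ∞ sincSq := by
  have h : ContDiff ℝ ∞ fun x : ℝ => (Real.sinc x : ℂ) :=
    Complex.ofRealCLM.contDiff.comp (contDiff_sinc ⊤)
  exact h.mul h

theorem norm_iteratedDeriv_sincSq_le (j : ℕ) (x : ℝ) :
    ‖iteratedDeriv j sincSq x‖ ≤ 5 * (1 + x ^ 2)⁻¹ * 2 ^ j := by
  have h : ContDiff ℝ ∞ fun x : ℝ => (Real.sinc x : ℂ) :=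
    Complex.ofRealCLM.contDiff.comp (contDiff_sinc ⊤)
  have h1 : ∀ k : ℕ, ‖iteratedDeriv k (fun y : ℝ => (Real.sinc y : ℂ)) x‖ ≤
      √(5 * (1 + x ^ 2)⁻¹) * 1 ^ k := fun k => by
    rw [norm_iteratedDeriv_ofReal_sinc, one_pow, mul_one]
    refine Real.le_sqrt_of_sq_le ?_
    rw [sq]
    exact abs_sincIntegral_mul_le k k x
  have h2 := norm_iteratedDeriv_mul_le_mul_add_pow h h (Real.sqrt_nonneg _) zero_le_one h1 h1 j
  rw [Real.mul_self_sqrt (by positivity), one_add_one_eq_two] at h2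
  exact h2

theorem tendsto_iteratedDeriv_mul_dilate {F G : ℝ → ℂ} (hF : ContDiff ℝ ∞ F)
    (hG : ContDiff ℝ ∞ G) (hG0 : G 0 = 1) (a : ℝ) (r : ℕ) :
    Tendsto (fun t : ℝ => iteratedDeriv r (fun x => G (a * t * x) * F ((1 - t) * x)) 0)
      (𝓝 0) (𝓝 (iteratedDeriv r F 0)) := by
  have hF' : ContDiff ℝ r F := hF.of_le (by exact_mod_cast le_top)
  have hG' : ContDiff ℝ r G := hG.of_le (by exact_mod_cast le_top)
  have h : (fun t : ℝ => iteratedDeriv r (fun x => G (a * t * x) * F ((1 - t) * x)) 0) =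
      fun t => ∑ i ∈ Finset.range (r + 1), (r.choose i : ℂ) *
        ((a * t) ^ i • iteratedDeriv i G 0) *
          ((1 - t) ^ (r - i) • iteratedDeriv (r - i) F 0) := by
    funext t
    have hGt : ContDiff ℝ r fun x => G (a * t * x) := hG'.comp (contDiff_const.mul contDiff_id)
    have hFt : ContDiff ℝ r fun x => F ((1 - t) * x) := hF'.comp (contDiff_const.mul contDiff_id)
    rw [iteratedDeriv_fun_mul hGt.contDiffAt hFt.contDiffAt]
    refine Finset.sum_congr rfl fun i hi => ?_
    have hi' : i ≤ r := Nat.lt_succ_iff.1 (Finset.mem_range.1 hi)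
    rw [iteratedDeriv_comp_const_smul (hG'.of_le (by exact_mod_cast hi')),
      iteratedDeriv_comp_const_smul (hF'.of_le (by exact_mod_cast Nat.sub_le r i))]
    simp
  rw [h]
  have hc : Continuous fun t : ℝ => ∑ i ∈ Finset.range (r + 1), (r.choose i : ℂ) *
        ((a * t) ^ i • iteratedDeriv i G 0) *
          ((1 - t) ^ (r - i) • iteratedDeriv (r - i) F 0) := by fun_prop
  convert! hc.tendsto 0 using 2
  -- At `t = 0` the factor `(a * t) ^ i` kills every Leibniz term with `i > 0`.
  rw [Finset.sum_eq_single 0 (fun i _ hi => by simp [hi]) (by simp)]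
  simp [hG0]

/-- A Paley–Wiener argument without complex analysis: `(2π|v|)^k ‖𝓕 h v‖ ≤ C σ^k` for all `k` is
impossible if `2π|v| > σ` and `𝓕 h v ≠ 0`. -/
theorem fourier_eq_zero_of_norm_iteratedDeriv_le {h : ℝ → ℂ} (hh : ContDiff ℝ ∞ h) {σ C : ℝ}
    (hσ : 0 < σ) (hint : ∀ k, Integrable (iteratedDeriv k h))
    (hC : ∀ k, ∫ x, ‖iteratedDeriv k h x‖ ≤ C * σ ^ k) {v : ℝ} (hv : σ < 2 * Real.pi * |v|) :
    𝓕 h v = 0 := by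
  by_contra hne
  have h1 : ∀ k : ℕ, (2 * Real.pi * |v| / σ) ^ k ≤ C / ‖𝓕 h v‖ := fun k => by
    have h2 := congrFun (Real.fourier_iteratedDeriv (N := ⊤) (n := k) hh (fun n _ => hint n) le_top) v
    have h3 : ‖𝓕 (iteratedDeriv k h) v‖ ≤ C * σ ^ k :=
      (VectorFourier.norm_fourierIntegral_le_integral_norm _ _ _ _ _).trans (hC k)
    rw [h2, norm_smul, norm_pow] at h3
    have h4 : ‖(2 * Real.pi * Complex.I * v : ℂ)‖ = 2 * Real.pi * |v| := by
      simp [abs_of_pos Real.pi_pos]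
    rw [h4] at h3
    rw [div_pow, le_div_iff₀ (norm_pos_iff.2 hne), div_mul_eq_mul_div, div_le_iff₀ (by positivity)]
    exact h3
  have h2 := tendsto_pow_atTop_atTop_of_one_lt ((one_lt_div hσ).2 hv)
  obtain ⟨k, hk⟩ := (h2.eventually_gt_atTop (C / ‖𝓕 h v‖)).exists
  exact absurd (h1 k) (not_le.2 hk)

/-! ### Coefficients and symbol for general `σ`. -/

/-- The nodes in terms of the offset. -/
theorem boasNode_eq (σ : ℝ) (r : ℕ) (k : ℤ) :
    boasNode σ r k = Real.pi / σ * (k - boasShift r) := by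
  rw [boasNode, boasShift_eq_ite]
  split_ifs
  · rfl
  · ring

/-- The two signs `(-1)^{k+1}` cancel, and the separately defined `B_{m,0}` is `-sinc^{(2m)}(0)`,
which fits the general formula. -/
theorem boasCoeff_eq (σ : ℝ) {r : ℕ} (hr : 1 ≤ r) (k : ℤ) :
    boasCoeff σ r k = (σ / Real.pi) ^ r * boasWeight r k := by
  have hs : ∀ a : ℝ, (-1) ^ (k + 1) * ((-1) ^ (k + 1) * a) = a := fun a => by
    rw [← mul_assoc, ← mul_zpow, neg_one_mul, neg_neg, one_zpow, one_mul]
  rcases Nat.even_or_odd' r with ⟨m, rfl | rfl⟩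
  · have hm : ¬ Odd (2 * m) := by simp
    rw [boasCoeff_even, boasB, boasWeight, boasShift_eq_ite, if_neg hm]
    split_ifs with hk
    · have h1 : ((2 * m : ℕ) : ℝ) * (Real.pi / 2) = m * Real.pi := by
        push_cast
        ring
      simp only [hk, sincIntegral, Int.cast_zero, sub_zero, mul_zero, zero_mul, zero_add, h1,
        Real.cos_nat_mul_pi, intervalIntegral.integral_mul_const, integral_pow]
      push_cast
      simp
      ring
    · rw [hs, iteratedDeriv_sincPi, zero_sub]
  · have hm : Odd (2 * m + 1) := ⟨m, rfl⟩
    have h := boasCoeff_odd σ (m + 1) (by omega) k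
    have h2 : 2 * (m + 1) - 1 = 2 * m + 1 := by omega
    rw [h2] at h
    rw [h, boasA, h2, hs, boasWeight, boasShift_eq_ite, if_pos hm, iteratedDeriv_sincPi]

theorem summable_abs_boasCoeff (σ : ℝ) {r : ℕ} (hr : 1 ≤ r) :
    Summable fun k => |boasCoeff σ r k| := by
  simp only [boasCoeff_eq σ hr]
  exact ((summable_boasWeight hr).mul_left _).abs

theorem hasSum_abs_boasCoeff {σ : ℝ} (hσ : 0 < σ) {r : ℕ} (hr : 1 ≤ r) :
    HasSum (fun k => |boasCoeff σ r k|) (σ ^ r) := by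
  have h := (hasSum_abs_boasWeight hr).mul_left ((σ / Real.pi) ^ r)
  rw [← mul_pow, div_mul_cancel₀ _ Real.pi_ne_zero] at h
  refine h.congr_fun fun k => ?_
  rw [boasCoeff_eq σ hr, abs_mul, abs_of_pos (by positivity)]

theorem hasSum_boasCoeff_mul_exp {σ : ℝ} (hσ : 0 < σ) {r : ℕ} (hr : 1 ≤ r) {v : ℝ}
    (hv : |v| ≤ σ / (2 * Real.pi)) :
    HasSum (fun k : ℤ => (boasCoeff σ r k : ℂ) *
      Complex.exp (2 * Real.pi * Complex.I * v * boasNode σ r k))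
      ((2 * Real.pi * Complex.I * v) ^ r) := by
  have hσ' : (σ : ℂ) ≠ 0 := Complex.ofReal_ne_zero.2 hσ.ne'
  have hpi : (Real.pi : ℂ) ≠ 0 := Complex.ofReal_ne_zero.2 Real.pi_ne_zero
  have hu : |2 * Real.pi * v / σ| ≤ 1 := by
    rw [le_div_iff₀ (by positivity)] at hv
    rw [abs_div, abs_mul, abs_of_pos hσ, abs_of_pos Real.two_pi_pos, div_le_one hσ]
    linarith
  have h := (hasSum_boasWeight_mul_exp hr hu).mul_left (((σ / Real.pi) ^ r : ℝ) : ℂ)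
  convert! h using 1
  · funext k
    rw [boasCoeff_eq σ hr, boasNode_eq, Complex.ofReal_mul, mul_assoc]
    congr 3
    push_cast
    field_simp
  · rw [Complex.ofReal_pow, ← mul_pow]
    congr 1
    push_cast
    field_simp

/-! ### The interpolation formula for bounded functions. -/

theorem eq_integral_exp_mul_fourier {h : ℝ → ℂ} (hc : Continuous h) (hint : Integrable h)
    (hF : Integrable (𝓕 h)) (x : ℝ) :
    h x = ∫ v : ℝ, Complex.exp (2 * Real.pi * Complex.I * v * x) * 𝓕 h v := by
  have h1 := congrFun (hc.fourierInv_fourier_eq hint hF) x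
  refine h1.symm.trans ?_
  rw [Real.fourierInv_eq']
  congr 1
  funext v
  rw [smul_eq_mul, real_inner_comm]
  congr 2
  simp
  ring

/-- Integrates the expansion of `(2πiv)^r` against `H`; absolute summability of the coefficients
justifies exchanging sum and integral. -/
theorem hasSum_of_integral_repr {σ : ℝ} (hσ : 0 < σ) {r : ℕ} (hr : 1 ≤ r) {h H : ℝ → ℂ}
    (hH : Integrable H) (hsupp : ∀ v : ℝ, σ / (2 * Real.pi) < |v| → H v = 0)
    (hinv : ∀ x : ℝ, h x = ∫ v : ℝ, Complex.exp (2 * Real.pi * Complex.I * v * x) * H v) :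
    HasSum (fun k : ℤ => (boasCoeff σ r k : ℂ) * h (boasNode σ r k))
      (∫ v : ℝ, (2 * Real.pi * Complex.I * v) ^ r * H v) := by
  have hnorm : ∀ x v : ℝ, ‖Complex.exp (2 * Real.pi * Complex.I * v * x)‖ = 1 := fun x v => by
    have : (2 * Real.pi * Complex.I * v * x : ℂ) = (2 * Real.pi * v * x : ℝ) * Complex.I := by
      push_cast
      ring
    rw [this, Complex.norm_exp_ofReal_mul_I]
  have key := hasSum_integral_of_summable_integral_norm
    (μ := (volume : Measure ℝ)) (F := fun (k : ℤ) (v : ℝ) => (boasCoeff σ r k : ℂ) *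
      (Complex.exp (2 * Real.pi * Complex.I * v * boasNode σ r k) * H v)) (fun k => ?_) ?_
  · simp only [integral_const_mul, ← hinv] at key
    convert! key using 1
    congr 1
    funext v
    by_cases hv : σ / (2 * Real.pi) < |v|
    · simp [hsupp v hv]
    · simp only [← mul_assoc]
      rw [tsum_mul_right, (hasSum_boasCoeff_mul_exp hσ hr (not_lt.1 hv)).tsum_eq]
  · refine (hH.bdd_mul (c := 1) (Continuous.aestronglyMeasurable (by fun_prop))
      (Eventually.of_forall fun v => (hnorm _ v).le)).const_mul _
  · simp only [norm_mul, integral_const_mul, hnorm, one_mul, Complex.norm_real, Real.norm_eq_abs]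
    exact (summable_abs_boasCoeff σ hr).mul_right _

theorem continuous_fourier_of_integrable {h : ℝ → ℂ} (hint : Integrable h) : Continuous (𝓕 h) :=
  VectorFourier.fourierIntegral_continuous Real.continuous_fourierChar
    (innerSL ℝ).continuous₂ hint

theorem hasSum_of_fourier_support {h : ℝ → ℂ} (hh : ContDiff ℝ ∞ h) {σ : ℝ}
    (hσ : 0 < σ) (hint : ∀ k, Integrable (iteratedDeriv k h)) {H : ℝ → ℂ} (hH : 𝓕 h = H)
    (hsupp : ∀ v : ℝ, σ / (2 * Real.pi) < |v| → H v = 0) {r : ℕ} (hr : 1 ≤ r) :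
    HasSum (fun k : ℤ => (boasCoeff σ r k : ℂ) * h (boasNode σ r k)) (iteratedDeriv r h 0) := by
  have hint0 : Integrable h := by simpa using hint 0
  have hcont : Continuous H := by
    rw [← hH]
    exact continuous_fourier_of_integrable hint0
  have hcpt : HasCompactSupport H :=
    HasCompactSupport.intro (isCompact_Icc (a := -(σ / (2 * Real.pi))) (b := σ / (2 * Real.pi)))
      fun v hv => hsupp v (by
        by_contra h1
        exact hv (abs_le.1 (not_lt.1 h1)))
  have hHi : Integrable H := hcont.integrable_of_hasCompactSupport hcpt
  have h3 : Continuous (iteratedDeriv r h) :=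
    hh.continuous_iteratedDeriv r (by exact_mod_cast le_top)
  have hder : 𝓕 (iteratedDeriv r h) = fun v : ℝ => (2 * Real.pi * Complex.I * v) ^ r • H v := by
    rw [← hH]
    exact Real.fourier_iteratedDeriv (N := ⊤) hh (fun n _ => hint n) le_top
  have h5 : Integrable fun v : ℝ => (2 * Real.pi * Complex.I * v) ^ r • H v := by
    have hc : Continuous fun v : ℝ => (2 * Real.pi * Complex.I * v : ℂ) ^ r := by fun_prop
    refine (hc.smul hcont).integrable_of_hasCompactSupport (hcpt.mono fun v hv => ?_)
    exact right_ne_zero_of_smul (a := (2 * Real.pi * Complex.I * v : ℂ) ^ r) hv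
  have h6 := eq_integral_exp_mul_fourier h3 (hint r) (by rw [hder]; exact h5) 0
  simp only [hder, Complex.ofReal_zero, mul_zero, Complex.exp_zero, one_mul, smul_eq_mul] at h6
  rw [h6]
  refine hasSum_of_integral_repr hσ hr hHi hsupp fun x => ?_
  have h7 := eq_integral_exp_mul_fourier hh.continuous hint0 (by rw [hH]; exact hHi) x
  rwa [hH] at h7

theorem hasSum_of_norm_iteratedDeriv_le_of_decay {h : ℝ → ℂ} (hh : ContDiff ℝ ∞ h) {σ C δ : ℝ}
    (hσ : 0 < σ) (hδ : 0 < δ)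
    (hC : ∀ k x, ‖iteratedDeriv k h x‖ ≤ C * (1 + (δ * x) ^ 2)⁻¹ * σ ^ k) {r : ℕ} (hr : 1 ≤ r) :
    HasSum (fun k : ℤ => (boasCoeff σ r k : ℂ) * h (boasNode σ r k)) (iteratedDeriv r h 0) := by
  have hi : ∀ k, Integrable fun x : ℝ => C * (1 + (δ * x) ^ 2)⁻¹ * σ ^ k := fun k =>
    ((integrable_inv_one_add_sq.comp_mul_left' hδ.ne').const_mul C).mul_const _
  have hint : ∀ k, Integrable (iteratedDeriv k h) := fun k =>
    (hi k).mono' (hh.continuous_iteratedDeriv k (by exact_mod_cast le_top)).aestronglyMeasurable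
      (Eventually.of_forall (hC k))
  refine hasSum_of_fourier_support hh hσ hint rfl (fun v hv => ?_) hr
  refine fourier_eq_zero_of_norm_iteratedDeriv_le hh hσ hint
    (C := ∫ x : ℝ, C * (1 + (δ * x) ^ 2)⁻¹) (fun k => ?_) (by
      rw [div_lt_iff₀ (by positivity)] at hv
      linarith)
  rw [← integral_mul_const]
  exact integral_mono (hint k).norm (hi k) (hC k)

/-- The damping factor has type `σt` and the contracted function type `(1 - t)σ`, so the product
keeps type `σ` while gaining integrable decay. -/
theorem hasSum_mul_dilate {F : ℝ → ℂ} (hF : ContDiff ℝ ∞ F) {σ M : ℝ} (hσ : 0 < σ)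
    (hM : ∀ k x, ‖iteratedDeriv k F x‖ ≤ M * σ ^ k) {r : ℕ} (hr : 1 ≤ r) {t : ℝ} (h0 : 0 < t)
    (h1 : t < 1) :
    HasSum (fun k : ℤ => (boasCoeff σ r k : ℂ) *
      (sincSq (σ / 2 * t * boasNode σ r k) * F ((1 - t) * boasNode σ r k)))
      (iteratedDeriv r (fun x => sincSq (σ / 2 * t * x) * F ((1 - t) * x)) 0) := by
  have hG : ContDiff ℝ ∞ fun x => sincSq (σ / 2 * t * x) :=
    contDiff_sincSq.comp (contDiff_const.mul contDiff_id)
  have hFt : ContDiff ℝ ∞ fun x => F ((1 - t) * x) := hF.comp (contDiff_const.mul contDiff_id)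
  refine hasSum_of_norm_iteratedDeriv_le_of_decay (C := 5 * M) (δ := σ / 2 * t) (hG.mul hFt) hσ
    (by positivity) (fun k x => ?_) hr
  have h := norm_iteratedDeriv_mul_le_mul_add_pow hG hFt (x := x)
    (A := 5 * (1 + (σ / 2 * t * x) ^ 2)⁻¹) (B := M) (a := σ * t) (b := (1 - t) * σ)
    (by positivity) (by positivity) (fun k => ?_) (fun k => ?_) k
  · refine h.trans (le_of_eq ?_)
    have : σ * t + (1 - t) * σ = σ := by ring
    rw [this]
    ring
  · rw [iteratedDeriv_comp_const_smul (contDiff_sincSq.of_le (by exact_mod_cast le_top)),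
      norm_smul, norm_pow, Real.norm_of_nonneg (by positivity)]
    refine (mul_le_mul_of_nonneg_left (norm_iteratedDeriv_sincSq_le k _)
      (by positivity)).trans (le_of_eq ?_)
    have : σ * t = σ / 2 * t * 2 := by ring
    rw [this, mul_pow _ 2]
    ring
  · have h1' : 0 ≤ 1 - t := by linarith
    rw [iteratedDeriv_comp_const_smul (hF.of_le (by exact_mod_cast le_top)),
      norm_smul, norm_pow, Real.norm_of_nonneg h1']
    refine (mul_le_mul_of_nonneg_left (hM k _) (by positivity)).trans (le_of_eq ?_)
    rw [mul_pow]
    ring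

/-- The Boas interpolation formula for functions of exponential type that are bounded on `ℝ`. -/
theorem iteratedDeriv_eq_tsum_boasCoeff {F : ℝ → ℂ} (hF : ContDiff ℝ ∞ F) {σ M : ℝ} (hσ : 0 < σ)
    (hM : ∀ k x, ‖iteratedDeriv k F x‖ ≤ M * σ ^ k) {r : ℕ} (hr : 1 ≤ r) :
    iteratedDeriv r F 0 = ∑' k : ℤ, (boasCoeff σ r k : ℂ) * F (boasNode σ r k) := by
  have hM' : ∀ x, ‖F x‖ ≤ M := fun x => by simpa using hM 0 x
  have hM0 : 0 ≤ M := (norm_nonneg _).trans (hM' 0)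
  have hG0 : sincSq 0 = 1 := by simp [sincSq]
  have hG1 : ∀ x, ‖sincSq x‖ ≤ 1 := fun x => by
    rw [sincSq, norm_mul, Complex.norm_real]
    exact mul_le_one₀ (Real.abs_sinc_le_one x) (norm_nonneg _) (Real.abs_sinc_le_one x)
  have hl : Tendsto (fun t : ℝ => iteratedDeriv r
      (fun x => sincSq (σ / 2 * t * x) * F ((1 - t) * x)) 0) (𝓝[>] 0)
      (𝓝 (iteratedDeriv r F 0)) :=
    (tendsto_iteratedDeriv_mul_dilate hF contDiff_sincSq hG0 (σ / 2) r).mono_left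
      nhdsWithin_le_nhds
  have hr' : Tendsto (fun t : ℝ => ∑' k : ℤ, (boasCoeff σ r k : ℂ) *
      (sincSq (σ / 2 * t * boasNode σ r k) * F ((1 - t) * boasNode σ r k))) (𝓝[>] 0)
      (𝓝 (∑' k : ℤ, (boasCoeff σ r k : ℂ) * F (boasNode σ r k))) := by
    -- The damped functions are bounded by `M` uniformly in `t`, so `t → 0⁺` may be taken termwise.
    refine tendsto_tsum_of_dominated_convergence (bound := fun k => |boasCoeff σ r k| * M)
      ((summable_abs_boasCoeff σ hr).mul_right M) (fun k => ?_) (Eventually.of_forall fun t k => ?_)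
    · have hc : Continuous fun t : ℝ => (boasCoeff σ r k : ℂ) *
          (sincSq (σ / 2 * t * boasNode σ r k) * F ((1 - t) * boasNode σ r k)) := by
        have := hF.continuous
        have := contDiff_sincSq.continuous
        fun_prop
      have h := hc.tendsto 0
      simp only [mul_zero, zero_mul, hG0, one_mul, sub_zero] at h
      exact h.mono_left nhdsWithin_le_nhds
    · rw [norm_mul, norm_mul, Complex.norm_real, Real.norm_eq_abs]
      refine mul_le_mul_of_nonneg_left ?_ (abs_nonneg _)
      exact (mul_le_mul (hG1 _) (hM' _) (norm_nonneg _) zero_le_one).trans_eq (one_mul M)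
  refine tendsto_nhds_unique hl (hr'.congr' ?_)
  filter_upwards [Ioo_mem_nhdsGT zero_lt_one] with t ht
  exact (hasSum_mul_dilate hF hσ hM hr ht.1 ht.2).tsum_eq

/-! ### Transfer to the isometry group. -/

namespace IsometryGroup

variable {𝕜 E : Type*} [RCLike 𝕜] [NormedAddCommGroup E] [NormedSpace 𝕜 E]

theorem op_add_apply (T : IsometryGroup 𝕜 E) (s t : ℝ) (f : E) :
    T.op (s + t) f = T.op s (T.op t f) := by
  rw [T.op_add]
  rfl

theorem HasGenerator.hasDerivAt [NormedSpace ℝ E] [IsScalarTower ℝ 𝕜 E] {T : IsometryGroup 𝕜 E}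
    {f g : E} (h : T.HasGenerator f g) (t : ℝ) :
    HasDerivAt (fun s : ℝ => T.op s f) (T.op t g) t := by
  rw [hasDerivAt_iff_tendsto_slope_zero]
  refine (((T.op t).continuous.tendsto g).comp h).congr fun s => ?_
  rw [Function.comp_apply, map_smul, map_sub, ← op_add_apply, ← RCLike.real_smul_eq_coe_smul]

/-- A vector all of whose iterated images under the generator exist is a smooth vector. -/
theorem exists_hasGenerator_seq (T : IsometryGroup 𝕜 E) {σ : ℝ} {f : E}
    (hf : f ∈ bernsteinSpace T.generator σ) :
    ∃ g : ℕ → E, g 0 = f ∧ (∀ k, T.HasGenerator (g k) (g (k + 1))) ∧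
      (∀ k, ‖g k‖ ≤ σ ^ k * ‖f‖) ∧
      ∀ k, ∃ h : f ∈ (T.generator.powOp k).domain, T.generator.powOp k ⟨f, h⟩ = g k := by
  choose h hb using hf
  have hgr : ∀ k, (f, T.generator.powOp k ⟨f, h k⟩) ∈ (T.generator.powOp k).graph := fun k =>
    (LinearPMap.mem_graph_iff _).2 ⟨⟨f, h k⟩, rfl, rfl⟩
  refine ⟨fun k => T.generator.powOp k ⟨f, h k⟩, rfl, fun k => ?_, hb, fun k => ⟨h k, rfl⟩⟩
  obtain ⟨y, hy, hz⟩ := (LinearPMap.mem_graph_prodOp _ _ _ _).1 (hgr (k + 1))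
  have hy' := LinearPMap.mem_graph_snd_inj _ hy (hgr k) rfl
  subst hy'
  exact (T.mem_graph_generator _ _).1 hz

theorem iteratedDeriv_op {F : Type*} [NormedAddCommGroup F] [NormedSpace ℝ F]
    [NormedSpace ℝ E] [IsScalarTower ℝ 𝕜 E] (T : IsometryGroup 𝕜 E) {g : ℕ → E}
    (hg : ∀ k, T.HasGenerator (g k) (g (k + 1))) (φ : E →L[ℝ] F) (k : ℕ) :
    iteratedDeriv k (fun t => φ (T.op t (g 0))) = fun t => φ (T.op t (g k)) := by
  induction k with
  | zero => rw [iteratedDeriv_zero]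
  | succ k ih =>
    rw [iteratedDeriv_succ, ih]
    exact funext fun t => (φ.hasFDerivAt.comp_hasDerivAt t ((hg k).hasDerivAt t)).deriv

theorem hasSum_boasOp [CompleteSpace E] (T : IsometryGroup 𝕜 E) (σ : ℝ) {r : ℕ} (hr : 1 ≤ r)
    (f : E) :
    HasSum (fun k : ℤ => (boasCoeff σ r k : 𝕜) • T.op (boasNode σ r k) f) (T.boasOp σ r f) := by
  refine (Summable.of_norm_bounded ((summable_abs_boasCoeff σ hr).mul_right ‖f‖)
    fun k => ?_).hasSum
  rw [norm_smul, T.norm_op_apply, RCLike.norm_ofReal]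

theorem norm_boasOp_le (T : IsometryGroup 𝕜 E) {σ : ℝ} (hσ : 0 < σ) {r : ℕ}
    (hr : 1 ≤ r) (f : E) : ‖T.boasOp σ r f‖ ≤ σ ^ r * ‖f‖ := by
  refine tsum_of_norm_bounded ((hasSum_abs_boasCoeff hσ hr).mul_right ‖f‖) fun k => ?_
  rw [norm_smul, T.norm_op_apply, RCLike.norm_ofReal]

theorem exists_continuousLinearMap_eq_boasOp [CompleteSpace E] (T : IsometryGroup 𝕜 E) {σ : ℝ}
    (hσ : 0 < σ) {r : ℕ} (hr : 1 ≤ r) :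
    ∃ L : E →L[𝕜] E, (∀ f : E, L f = T.boasOp σ r f) ∧ ‖L‖ ≤ σ ^ r := by
  let L : E →ₗ[𝕜] E :=
    { toFun := T.boasOp σ r
      map_add' := fun f g => (T.hasSum_boasOp σ hr (f + g)).unique (by
        simpa only [map_add, smul_add] using (T.hasSum_boasOp σ hr f).add (T.hasSum_boasOp σ hr g))
      map_smul' := fun c f => (T.hasSum_boasOp σ hr (c • f)).unique (by
        simpa only [map_smul, smul_comm c, RingHom.id_apply] using (T.hasSum_boasOp σ hr f).const_smul c) }
  exact ⟨L.mkContinuous (σ ^ r) (T.norm_boasOp_le hσ hr), fun f => rfl,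
    L.mkContinuous_norm_le (by positivity) _⟩

theorem eq_boasOp_of_hasGenerator [CompleteSpace E] (T : IsometryGroup 𝕜 E) {σ M : ℝ}
    (hσ : 0 < σ) {r : ℕ} (hr : 1 ≤ r) {g : ℕ → E} (hg : ∀ k, T.HasGenerator (g k) (g (k + 1)))
    (hb : ∀ k, ‖g k‖ ≤ σ ^ k * M) : g r = T.boasOp σ r (g 0) := by
  let _ : NormedSpace ℝ E := NormedSpace.restrictScalars ℝ 𝕜 E
  have : IsScalarTower ℝ 𝕜 E := RestrictScalars.isScalarTower ℝ 𝕜 E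
  rw [SeparatingDual.eq_iff_forall_dual_eq (R := ℝ)]
  intro φ
  -- A real functional viewed in `ℂ` lets the complex-valued formula serve both scalar fields.
  let ψ : E →L[ℝ] ℂ := Complex.ofRealCLM.comp φ
  have hder := T.iteratedDeriv_op hg ψ
  have hF : ContDiff ℝ ∞ fun t => ψ (T.op t (g 0)) :=
    contDiff_of_differentiable_iteratedDeriv fun k _ t => by
      rw [hder]
      exact (ψ.hasFDerivAt.comp_hasDerivAt t ((hg k).hasDerivAt t)).differentiableAt
  have h := iteratedDeriv_eq_tsum_boasCoeff hF hσ (M := ‖ψ‖ * M) (fun k t => by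
    rw [hder]
    refine (ψ.le_opNorm _).trans ?_
    rw [T.norm_op_apply, mul_assoc, mul_comm M]
    exact mul_le_mul_of_nonneg_left (hb k) (norm_nonneg _)) hr
  have h2 := (T.hasSum_boasOp σ hr (g 0)).mapL ψ
  have h3 : ∀ k : ℤ, ψ ((boasCoeff σ r k : 𝕜) • T.op (boasNode σ r k) (g 0)) =
      (boasCoeff σ r k : ℂ) * ψ (T.op (boasNode σ r k) (g 0)) := fun k => by
    rw [← RCLike.real_smul_eq_coe_smul, map_smul, Complex.real_smul]
  simp only [h3] at h2
  rw [h2.tsum_eq, hder] at h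
  simp only [T.op_zero, ContinuousLinearMap.id_apply] at h
  exact Complex.ofReal_injective h

/-- The shifted partial sum is `e^{tD}` of the unshifted one, so its distance to the limit does not
depend on `t`. -/
theorem tendstoUniformly_sum_op (T : IsometryGroup 𝕜 E) {ι : Type*} {c : ι → 𝕜} {x : ι → ℝ}
    {f g : E} (h : HasSum (fun k => c k • T.op (x k) f) g) :
    TendstoUniformly (fun (S : Finset ι) (t : ℝ) => ∑ k ∈ S, c k • T.op (t + x k) f)
      (fun t => T.op t g) atTop := by
  rw [Metric.tendstoUniformly_iff]
  intro ε hε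
  filter_upwards [Metric.tendsto_nhds.1 h ε hε] with S hS t
  have h1 : ∑ k ∈ S, c k • T.op (t + x k) f = T.op t (∑ k ∈ S, c k • T.op (x k) f) := by
    simp only [map_sum, map_smul, op_add_apply]
  rwa [h1, dist_eq_norm, ← map_sub, T.norm_op_apply, ← dist_eq_norm, dist_comm]

end IsometryGroup

theorem mainTheorem7 {𝕜 E : Type*} [RCLike 𝕜] [NormedAddCommGroup E] [NormedSpace 𝕜 E]
    [CompleteSpace E] (T : IsometryGroup 𝕜 E) (σ : ℝ) (hσ : 0 < σ) (r : ℕ) (hr : 1 ≤ r) :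
    (∀ f : E, HasSum (fun k : ℤ => (boasCoeff σ r k : 𝕜) • T.op (boasNode σ r k) f)
      (T.boasOp σ r f)) ∧
    (∃ L : E →L[𝕜] E, (∀ f : E, L f = T.boasOp σ r f) ∧ ‖L‖ ≤ σ ^ r) ∧
    (∀ f ∈ bernsteinSpace T.generator σ,
      ∃ h : f ∈ (T.generator.powOp r).domain,
        T.generator.powOp r ⟨f, h⟩ = T.boasOp σ r f ∧
        TendstoUniformly
          (fun (S : Finset ℤ) (t : ℝ) =>
            ∑ k ∈ S, (boasCoeff σ r k : 𝕜) • T.op (t + boasNode σ r k) f)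
          (fun t : ℝ => T.op t (T.generator.powOp r ⟨f, h⟩)) atTop) := by
  refine ⟨T.hasSum_boasOp σ hr, T.exists_continuousLinearMap_eq_boasOp hσ hr, fun f hf => ?_⟩
  obtain ⟨g, rfl, hg, hb, hp⟩ := T.exists_hasGenerator_seq hf
  obtain ⟨h, hh⟩ := hp r
  have hr' := hh.trans (T.eq_boasOp_of_hasGenerator hσ hr hg hb)
  refine ⟨h, hr', ?_⟩
  rw [hr']
  exact T.tendstoUniformly_sum_op (T.hasSum_boasOp σ hr (g 0))
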